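/- Let $\mathbb K$ be a field of prime characteristic $p$ with algebraic closure $\overline{\mathbb K}$, let $n$ be a positive integer not divisible by $p$, let $h\in\mathbb F_p\subset\mathbb K$, $h\neq 0$, and let $\tilde h\in\mathbb Z$ be the representative of $h$ with $1\le\tilde h\le p-1$. Put $z=(z_1,\dots,z_n)$, $P(x,z)=\prod_{s=1}^n(x-z_s)\in\mathbb K[x,z]$, and define vectors of polynomials $Q^{(i)}(z,h)=(Q^{(i)}_1(z,h),\dots,Q^{(i)}_n(z,h))^\intercal$ by $$P(x,z)^{\tilde h}\Big(\frac1{x-z_1},\dots,\frac1{x-z_n}\Big)^\intercal=\sum_i Q^{(i)}(z,h)\,x^i .$$ Let $V\otimes\overline{\mathbb K}$ be the space of vectors in $\overline{\mathbb K}^{\,n}$ with zero sum of coordinates, and let $S(\overline{\mathbb K})$ be the set of points $a\in\overline{\mathbb K}^{\,n}$ with pairwise distinct coordinates. Then for every $a\in S(\overline{\mathbb K})$ the vectors $Q^{(\ell p-1)}(a,h)$, $\ell=1,\dots,\big[\frac{n\tilde h}{p}\big]$, belong to $V\otimes\overline{\mathbb K}$ and are linearly independent over $\overline{\mathbb K}$.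 -/

import Mathlib

open Polynomial

noncomputable section

namespace KZ

/-- The set of `L`-points of the scheme `S`, the complement in affine `n`-space of all the
diagonal hyperplanes `z_i = z_j`, `i ≠ j`. -/
def configurationPoints (n : ℕ) (L : Type*) [Field L] : Set (Fin n → L) :=
  {a | ∀ i j : Fin n, i ≠ j → a i ≠ a j}

/-- The space `V ⊗ L` of `n`-vectors over `L` with zero sum of coordinates. -/
def V (n : ℕ) (L : Type*) [Field L] : Submodule L (Fin n → L) where
  carrier := {v | ∑ i, v i = 0}
  zero_mem' := by simp
  add_mem' := by
    intro v w hv hw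
    simp only [Set.mem_setOf_eq] at hv hw ⊢
    simp [Finset.sum_add_distrib, hv, hw]
  smul_mem' := by
    intro c v hv
    simp only [Set.mem_setOf_eq] at hv ⊢
    simp [← Finset.mul_sum, hv]

/-- `P(x,z) = ∏ (x - z_s)`, as a polynomial in `x` over `K[z_1, …, z_n]`. -/
def P (n : ℕ) (K : Type*) [Field K] : (MvPolynomial (Fin n) K)[X] :=
  ∏ s : Fin n, (X - C (MvPolynomial.X s))

/-- The coordinate `Q_j(x,z,h) = P(x,z)^h̃ / (x - z_j)` of the vector `Q(x,z,h)`, where `h̃ = h.val`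
is the representative of `h` with `1 ≤ h̃ ≤ p - 1` (for `h ≠ 0`). The division by the monic
polynomial `x - z_j` is exact, see `mul_Q`. -/
def Q (n : ℕ) (K : Type*) [Field K] {p : ℕ} (h : ZMod p) (j : Fin n) :
    (MvPolynomial (Fin n) K)[X] :=
  P n K ^ h.val /ₘ (X - C (MvPolynomial.X j))

theorem mul_Q (n : ℕ) (K : Type*) [Field K] {p : ℕ} (h : ZMod p) (hh : h ≠ 0) (j : Fin n) :
    (X - C (MvPolynomial.X j)) * Q n K h j = P n K ^ h.val := by
  unfold Q
  rw [Polynomial.mul_divByMonic_eq_iff_isRoot]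
  have h0 : h.val ≠ 0 := fun e => hh ((ZMod.val_eq_zero h).1 e)
  have hP : eval (MvPolynomial.X j) (P n K) = 0 := by
    unfold P
    rw [eval_prod]
    exact Finset.prod_eq_zero (Finset.mem_univ j) (by simp)
  simp [IsRoot, eval_pow, hP, h0]

/-- The vector of polynomials `Q^{(i)}(z,h)`: the coefficient of `x^i` in `Q(x,z,h)`. -/
def Qcoeff (n : ℕ) (K : Type*) [Field K] {p : ℕ} (h : ZMod p) (i : ℕ) :
    Fin n → MvPolynomial (Fin n) K :=
  fun j => (Q n K h j).coeff i

/-- The value `Q^{(i)}(a,h)` at a point `a` with coordinates in an extension `L` of `K`. -/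
def Qvalue {n : ℕ} (K : Type*) [Field K] {L : Type*} [Field L] [Algebra K L] {p : ℕ}
    (h : ZMod p) (i : ℕ) (a : Fin n → L) : Fin n → L :=
  fun j => MvPolynomial.aeval a (Qcoeff n K h i j)

end KZ

end

namespace KZ

variable {L : Type*} [Field L] {p : ℕ}

/-! Let `F = ∏ (x - a_s)` and `k = h̃ - 1`. Coordinate `j` of `Q` at `a` is `F ^ k` times the
product of the `x - a_s` with `s ≠ j`. These products span the polynomials of degree `< n`, so a
relation among the vectors forces `n` consecutive coefficients of `W = F ^ k * c` to vanish, just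
below `x ^ N`, where `N = d * p`, `d = [n h̃ / p]` and `c` is a polynomial in `x ^ p` encoding the
relation. The gap splits `W` into two parts, and the equation `F W' = k F' W` passes to the upper
one, as `(x ^ N)' = 0`. Separability of `F` then makes the upper part divisible by `F ^ k`, and
degrees give `c = 0` (`eq_zero_of_coeff_window`). -/

/-- A polynomial solution `B` of `F B' = k F' B` with `F` separable is divisible by `F ^ k`,
for `k` smaller than the characteristic. -/
lemma pow_dvd_of_mul_derivative_eq [CharP L p] {F : L[X]} (hF : F.Separable) (hF0 : F ≠ 0) {k : ℕ}
    (hk : k < p) {B : L[X]} (hB : F * derivative B = C (k : L) * derivative F * B) :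
    F ^ k ∣ B := by
  induction k generalizing B with
  | zero => simp
  | succ k ih =>
    have hk0 : ((k + 1 : ℕ) : L) ≠ 0 := by
      rw [Ne, CharP.cast_eq_zero_iff L p]
      exact fun hd => absurd (Nat.le_of_dvd k.succ_pos hd) (by omega)
    have hu : IsUnit (C ((k + 1 : ℕ) : L)) := isUnit_C.2 hk0.isUnit
    have hdvd : F ∣ C ((k + 1 : ℕ) : L) * (derivative F * B) :=
      ⟨derivative B, by rw [hB, mul_assoc]⟩
    -- `F` is coprime to `F'`; cancelling one factor `F` lowers the exponent by one.
    obtain ⟨G, rfl⟩ : F ∣ B := hF.dvd_of_dvd_mul_left (hu.dvd_mul_left.1 hdvd)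
    have hG : F * derivative G = C (k : L) * derivative F * G := by
      apply mul_left_cancel₀ hF0
      rw [derivative_mul] at hB
      push_cast [C_add, C_1] at hB ⊢
      linear_combination hB
    rw [pow_succ']
    exact mul_dvd_mul_left F (ih (by omega) hG)

/-- If `C' = 0` and the `natDegree F` coefficients of `F ^ k * C` just below `x ^ N` vanish, where
`p ∣ N` and `natDegree C < N ≤ (k + 1) * natDegree F`, then `C = 0`. -/
lemma eq_zero_of_coeff_window [CharP L p] {F : L[X]} (hF : F.Separable) (hF0 : F ≠ 0)
    {k : ℕ} (hk : k < p) {N : ℕ} (hpN : p ∣ N) (hN : N ≤ (k + 1) * F.natDegree)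
    {c : L[X]} (hc : derivative c = 0) (hcN : c.natDegree < N)
    (hwin : ∀ i < N, N ≤ i + F.natDegree → (F ^ k * c).coeff i = 0) : c = 0 := by
  by_contra hc0
  set W := F ^ k * c with hW
  have hW0 : W ≠ 0 := mul_ne_zero (pow_ne_zero _ hF0) hc0
  have hWdeg : W.natDegree = k * F.natDegree + c.natDegree := by
    rw [hW, natDegree_mul (pow_ne_zero _ hF0) hc0, natDegree_pow]
  have hWeq : F * derivative W = C (k : L) * derivative F * W := by
    rw [hW, derivative_mul, hc, derivative_pow]
    rcases k with _ | k
    · simp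
    · simp only [Nat.add_sub_cancel, pow_succ]
      ring
  set A := W %ₘ (X ^ N : L[X]) with hA
  set B := W /ₘ (X ^ N : L[X]) with hBdef
  have hWAB : A + X ^ N * B = W := modByMonic_add_div W (X ^ N)
  have hAdeg : A.degree < N := by
    simpa using degree_modByMonic_lt W (monic_X_pow (R := L) N)
  have hXN : derivative (X ^ N : L[X]) = 0 := by
    rw [derivative_X_pow, (CharP.cast_eq_zero_iff L p N).2 hpN]
    simp
  have hAwin : A = 0 ∨ A.natDegree + F.natDegree < N := by
    by_contra! hcon
    obtain ⟨hA0, hAd⟩ := hcon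
    have hlt : A.natDegree < N := (natDegree_lt_iff_degree_lt hA0).2 hAdeg
    have h1 := hwin A.natDegree hlt hAd
    rw [← hWAB, coeff_add, coeff_X_pow_mul', if_neg (by omega), add_zero] at h1
    exact hA0 (leadingCoeff_eq_zero.1 h1)
  -- The gap gives `deg E < N`, while `X ^ N ∣ E`; hence `E = 0`.
  set E := F * derivative A - C (k : L) * derivative F * A with hE
  have hEB : E = X ^ N * (C (k : L) * derivative F * B - F * derivative B) := by
    rw [← hWAB, derivative_add, derivative_mul, hXN] at hWeq
    rw [hE]
    linear_combination hWeq
  have hEdeg : E.degree < (N : WithBot ℕ) := by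
    rcases hAwin with h0 | hlt
    · have : E = 0 := by rw [hE, h0]; simp
      rw [this, degree_zero]
      exact WithBot.bot_lt_coe N
    · refine lt_of_le_of_lt degree_le_natDegree ?_
      have h1 : (F * derivative A).natDegree ≤ F.natDegree + A.natDegree :=
        natDegree_mul_le.trans (Nat.add_le_add_left
          ((natDegree_derivative_le A).trans (Nat.sub_le _ _)) _)
      have h2 : (C (k : L) * derivative F * A).natDegree ≤ F.natDegree + A.natDegree :=
        natDegree_mul_le.trans (Nat.add_le_add_right
          ((natDegree_C_mul_le _ _).trans
            ((natDegree_derivative_le F).trans (Nat.sub_le _ _))) _)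
      have h3 : E.natDegree ≤ F.natDegree + A.natDegree :=
        (natDegree_sub_le _ _).trans (max_le h1 h2)
      exact_mod_cast (show E.natDegree < N by omega)
  have hB : F * derivative B = C (k : L) * derivative F * B := by
    have hE0 : E = 0 := by
      refine eq_zero_of_dvd_of_degree_lt (p := X ^ N) ⟨_, hEB⟩ ?_
      rwa [degree_X_pow]
    rw [hE0] at hEB
    have := (mul_eq_zero.1 hEB.symm).resolve_left (pow_ne_zero _ X_ne_zero)
    exact (sub_eq_zero.1 this).symm
  -- If `B = 0`, then `deg W + deg F < N ≤ (k + 1) deg F`, too small for a multiple of `F ^ k`.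
  -- Otherwise `deg B = k deg F + deg c - N < k deg F`, against `F ^ k ∣ B`.
  by_cases hB0 : B = 0
  · have hAW : A = W := by rw [← hWAB, hB0, mul_zero, add_zero]
    rw [hAW] at hAwin
    have := hAwin.resolve_left hW0
    rw [add_mul, one_mul] at hN
    omega
  · have h1 := natDegree_le_of_dvd (pow_dvd_of_mul_derivative_eq hF hF0 hk hB) hB0
    rw [natDegree_pow] at h1
    have h2 : B.natDegree = W.natDegree - N := by
      rw [hBdef, natDegree_divByMonic _ (monic_X_pow N), natDegree_X_pow]
    have h3 : W.natDegree - N < k * F.natDegree ∨ c.natDegree ≥ N := by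
      by_cases h4 : W.natDegree < N
      · exfalso
        exact hB0 ((divByMonic_eq_zero_iff (monic_X_pow N)).2
          ((degree_lt_degree (by simpa using h4))))
      · left; omega
    omega

lemma Q_map_aeval (K : Type*) [Field K] [Algebra K L] {n : ℕ} {h : ZMod p}
    (hh : h ≠ 0) (a : Fin n → L) (j : Fin n) :
    (Q n K h j).map (MvPolynomial.aeval a : MvPolynomial (Fin n) K →ₐ[K] L).toRingHom =
      Lagrange.nodal Finset.univ a ^ (h.val - 1) *
        Lagrange.nodal (Finset.univ.erase j) a := by
  have h0 : h.val ≠ 0 := fun e => hh ((ZMod.val_eq_zero h).1 e)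
  have hm := congrArg (Polynomial.map
    (MvPolynomial.aeval a : MvPolynomial (Fin n) K →ₐ[K] L).toRingHom) (mul_Q n K h hh j)
  rw [Polynomial.map_mul, Polynomial.map_pow, P, Polynomial.map_prod] at hm
  simp only [Polynomial.map_sub, map_X, map_C, AlgHom.toRingHom_eq_coe, RingHom.coe_coe,
    MvPolynomial.aeval_X] at hm
  apply mul_left_cancel₀ (X_sub_C_ne_zero (a j))
  rw [AlgHom.toRingHom_eq_coe, hm, ← Lagrange.nodal_eq]
  conv_lhs => rw [← Nat.sub_add_cancel (Nat.one_le_iff_ne_zero.2 h0), pow_succ]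
  rw [Lagrange.nodal_eq_mul_nodal_erase (Finset.mem_univ j) (s := Finset.univ) (v := a)]
  ring

lemma Qvalue_eq_coeff (K : Type*) [Field K] [Algebra K L] {n : ℕ} {h : ZMod p}
    (hh : h ≠ 0) (i : ℕ) (a : Fin n → L) (j : Fin n) :
    Qvalue K h i a j = (Lagrange.nodal Finset.univ a ^ (h.val - 1) *
        Lagrange.nodal (Finset.univ.erase j) a).coeff i := by
  rw [← Q_map_aeval K hh, coeff_map]
  rfl

/-- The coefficients of `x ^ i` with `p ∣ i + 1` in the vector `Q` have zero sum. -/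
lemma Qvalue_mem_V [CharP L p] [Fact p.Prime] (K : Type*) [Field K] [Algebra K L] {n : ℕ}
    {h : ZMod p} (hh : h ≠ 0) {i : ℕ} (hi : p ∣ i + 1) (a : Fin n → L) : Qvalue K h i a ∈ V n L := by
  change ∑ j, Qvalue K h i a j = 0
  simp only [Qvalue_eq_coeff K hh]
  -- The sum over `j` is `F ^ (h̃ - 1) * F' = (F ^ h̃)' / h̃`, whose coefficient at `x ^ i` carries
  -- the factor `i + 1 = 0`.
  rw [← finsetSum_coeff, ← Finset.mul_sum, ← Lagrange.derivative_nodal]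
  have h0 : (h.val : L) ≠ 0 := by
    rw [Ne, CharP.cast_eq_zero_iff L p]
    intro hd
    have := Nat.le_of_dvd
      (Nat.pos_of_ne_zero fun e => hh ((ZMod.val_eq_zero h).1 e)) hd
    exact absurd (ZMod.val_lt h) (by omega)
  have hder := coeff_derivative (Lagrange.nodal Finset.univ a ^ h.val) i
  have hi0 : ((i : L) + 1) = 0 := by
    exact_mod_cast (CharP.cast_eq_zero_iff L p (i + 1)).2 hi
  rw [hi0, mul_zero, derivative_pow, mul_assoc, coeff_C_mul] at hder
  exact (mul_eq_zero.1 hder).resolve_left h0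

/-- A linear functional that vanishes on all `∏ s ≠ j, (x - a s)`, for distinct `a s`,
vanishes on the polynomials of degree less than the number of points. -/
lemma eq_zero_of_nodal_erase {n : ℕ} {a : Fin n → L} (ha : Function.Injective a)
    (φ : L[X] →ₗ[L] L) (hφ : ∀ j, φ (Lagrange.nodal (Finset.univ.erase j) a) = 0)
    {r : L[X]} (hr : r.degree < n) : φ r = 0 := by
  rw [Lagrange.eq_interpolate (f := r) (s := Finset.univ) (v := a) ha.injOn (by simpa using hr),
    Lagrange.interpolate_apply, map_sum]
  refine Finset.sum_eq_zero fun j _ => ?_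
  rw [Lagrange.basis_eq_prod_sub_inv_mul_nodal_div (Finset.mem_univ j),
    ← Lagrange.nodal_erase_eq_nodal_div (Finset.mem_univ j), ← smul_eq_C_mul, ← smul_eq_C_mul,
    map_smul, map_smul, hφ, smul_zero, smul_zero]

lemma linearIndependent_Qvalue [CharP L p] [Fact p.Prime] (K : Type*) [Field K] [Algebra K L]
    {n : ℕ} {h : ZMod p} (hh : h ≠ 0) {a : Fin n → L} (ha : Function.Injective a) :
    LinearIndependent L
      (fun ℓ : Finset.Icc 1 (n * h.val / p) => Qvalue K h ((ℓ : ℕ) * p - 1) a) := by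
  have hp : 0 < p := (Fact.out : p.Prime).pos
  have h0 : h.val ≠ 0 := fun e => hh ((ZMod.val_eq_zero h).1 e)
  set d := n * h.val / p with hd
  set F := Lagrange.nodal Finset.univ a with hFdef
  have hFdeg : F.natDegree = n := by simp [hFdef]
  rw [Fintype.linearIndependent_iff]
  intro g hg ℓ₀
  have hℓ : ∀ ℓ : Finset.Icc 1 d, 1 ≤ (ℓ : ℕ) ∧ (ℓ : ℕ) ≤ d := fun ℓ => Finset.mem_Icc.1 ℓ.2
  -- The shifts by `(d - ℓ) * p` move every index `ℓ * p - 1` to the common index `d * p - 1`.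
  set c : L[X] := ∑ ℓ : Finset.Icc 1 d, C (g ℓ) * X ^ ((d - ℓ) * p) with hc
  have hd1 : 1 ≤ d := (hℓ ℓ₀).1.trans (hℓ ℓ₀).2
  have hdp : p ≤ d * p := Nat.le_mul_of_pos_left p hd1
  have hcoeff (f : L[X]) :
      (c * f).coeff (d * p - 1) = ∑ ℓ : Finset.Icc 1 d, g ℓ * f.coeff ((ℓ : ℕ) * p - 1) := by
    rw [hc, Finset.sum_mul, finsetSum_coeff]
    refine Finset.sum_congr rfl fun ℓ _ => ?_
    obtain ⟨h1, h2⟩ := hℓ ℓ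
    have h3 : (d - ℓ) * p + ℓ * p = d * p := by rw [← add_mul, Nat.sub_add_cancel h2]
    have h4 : p ≤ ℓ * p := Nat.le_mul_of_pos_left p h1
    rw [mul_assoc, coeff_C_mul, coeff_X_pow_mul', if_pos (by omega)]
    congr 2
    omega
  let φ : L[X] →ₗ[L] L :=
    lcoeff L (d * p - 1) ∘ₗ LinearMap.mulLeft L (F ^ (h.val - 1) * c)
  have hφ (j : Fin n) : φ (Lagrange.nodal (Finset.univ.erase j) a) = 0 := by
    have hj := congrFun hg j
    simp only [Finset.sum_apply, Pi.smul_apply, smul_eq_mul, Pi.zero_apply,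
      Qvalue_eq_coeff K hh] at hj
    rw [← hj, ← hcoeff]
    simp only [φ, LinearMap.comp_apply, LinearMap.mulLeft_apply, lcoeff_apply]
    congr 1
    ring
  have hwin : ∀ i < d * p, d * p ≤ i + F.natDegree → (F ^ (h.val - 1) * c).coeff i = 0 := by
    intro i hi hin
    rw [hFdeg] at hin
    -- Testing `φ` on a monomial of degree `< n` reads off one coefficient of the window.
    have hz := eq_zero_of_nodal_erase ha φ hφ (r := X ^ (d * p - 1 - i)) (by
      rw [degree_X_pow]
      exact_mod_cast (show d * p - 1 - i < n by omega))
    simp only [φ, LinearMap.comp_apply, LinearMap.mulLeft_apply, lcoeff_apply] at hz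
    rw [coeff_mul_X_pow', if_pos (Nat.sub_le _ _)] at hz
    rwa [show d * p - 1 - (d * p - 1 - i) = i by omega] at hz
  have hc0 : c = 0 := by
    refine eq_zero_of_coeff_window (p := p) (F := F) (k := h.val - 1) (N := d * p)
      (separable_prod_X_sub_C_iff.2 ha) Lagrange.nodal_ne_zero
      ((Nat.sub_le _ _).trans_lt (ZMod.val_lt h)) (dvd_mul_left _ _) ?_ ?_ ?_ hwin
    · rw [Nat.sub_add_cancel (Nat.one_le_iff_ne_zero.2 h0), hFdeg, mul_comm h.val]
      exact Nat.div_mul_le_self _ _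
    · rw [hc, derivative_sum]
      refine Finset.sum_eq_zero fun ℓ _ => ?_
      rw [derivative_C_mul_X_pow, (CharP.cast_eq_zero_iff L p _).2 (dvd_mul_left _ _)]
      simp
    · refine (natDegree_sum_le_of_forall_le (n := d * p - p) _ _ fun ℓ _ => ?_).trans_lt (by omega)
      refine (natDegree_C_mul_X_pow_le _ _).trans ?_
      rw [Nat.sub_mul]
      exact Nat.sub_le_sub_left (Nat.le_mul_of_pos_left p (hℓ ℓ).1) _
  have hcf := congrArg (fun f => coeff f ((d - ℓ₀) * p)) hc0
  simp only [hc, finsetSum_coeff, coeff_C_mul_X_pow, coeff_zero] at hcf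
  rw [Finset.sum_eq_single ℓ₀] at hcf
  · simpa using hcf
  · intro ℓ _ hne
    rw [if_neg]
    intro he
    have := Nat.eq_of_mul_eq_mul_right hp he
    have h1 := hℓ ℓ
    have h2 := hℓ ℓ₀
    exact hne (Subtype.ext (by omega))
  · simp

end KZ

theorem mainTheorem12 (p : ℕ) [Fact p.Prime] (K : Type*) [Field K] [CharP K p]
    (n : ℕ) (hpn : ¬ p ∣ n) (h : ZMod p) (hh : h ≠ 0)
    (a : Fin n → AlgebraicClosure K)
    (ha : a ∈ KZ.configurationPoints n (AlgebraicClosure K)) :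
    (∀ ℓ ∈ Finset.Icc 1 (n * h.val / p),
      KZ.Qvalue K h (ℓ * p - 1) a ∈ KZ.V n (AlgebraicClosure K)) ∧
    LinearIndependent (AlgebraicClosure K)
      (fun ℓ : Finset.Icc 1 (n * h.val / p) => KZ.Qvalue K h ((ℓ : ℕ) * p - 1) a) := by
  have : CharP (AlgebraicClosure K) p := charP_of_injective_algebraMap' K p
  refine ⟨fun ℓ hℓ => KZ.Qvalue_mem_V K hh ?_ a, KZ.linearIndependent_Qvalue K hh ?_⟩
  · have h1 : 0 < ℓ * p := Nat.mul_pos (Finset.mem_Icc.1 hℓ).1 (Fact.out : p.Prime).pos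
    rw [Nat.sub_add_cancel h1]
    exact dvd_mul_left p ℓ
  · intro i j hij
    by_contra hne
    exact ha i j hne hij
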